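/- Let $d\ge 1$ and $n_1,\dots,n_d\in\mathbb N_0$. Regard $\mathbb R^{n_1}\otimes\cdots\otimes\mathbb R^{n_d}$ as the space of real arrays $T=(t_{i_1\dots i_d})$, with the Frobenius inner product $\langle T,S\rangle=\sum_{i_1,\dots,i_d}t_{i_1\dots i_d}s_{i_1\dots i_d}$. A tensor $T$ has multilinear (Tucker) rank $\mathbf r=(r_1,\dots,r_d)\in\mathbb N_0^d$ if $\mathbf r$ is the minimum, in the componentwise order, of the tuples $(\dim W_1,\dots,\dim W_d)$ over all linear subspaces $W_j\subseteq\mathbb R^{n_j}$ with $T\in W_1\otimes\cdots\otimes W_d$. Let $\mathcal T_{d,\mathbf r}$ be the (possibly empty) set of all tensors of multilinear rank $\mathbf r$. For a smooth embedded $m$-dimensional submanifold $M$ of a Euclidean space, with a smooth local parametrization $\rho:U\to M$, $U\subseteq\mathbb R^m$ open, and Gram matrix $G=(\langle\partial_i\rho,\partial_j\rho\rangle)_{i,j}$, the mean curvature vector at $\rho(u)$ is $H_{\rho(u)}=\sum_{i,j=1}^m (G^{-1})_{ij}\,(\partial_i\partial_j\rho(u))^{\perp}$, where $\perp$ denotes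 the component normal to $M$. The submanifold $M$ is called minimal if its mean curvature vector vanishes at every point (in every local parametrization). **Theorem.** For all $d\ge1$, all $n_1,\dots,n_d$ and all $\mathbf r\in\mathbb N_0^d$, the set $\mathcal T_{d,\mathbf r}$ is a smooth embedded submanifold of $\mathbb R^{n_1}\otimes\cdots\otimes\mathbb R^{n_d}$, of dimension $\sum_{j=1}^d r_j(n_j-r_j)+\prod_{j=1}^d r_j$ if it is non-empty, and it is minimal: its mean curvature vector field is identically zero. In particular, for $d=2$ and every $r\in\mathbb N_0$, the set $\mathcal T_{2,(r,r)}$ is the set of real $n_1\times n_2$ matrices of rank $r$, and this set is (if non-empty) a minimal submanifold of dimension $r(n_1-r)+r(n_2-r)+r^2$. -/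

import Mathlib

open scoped ContDiff

noncomputable section

namespace TensorMinimality

section Submanifolds

variable {E : Type*} [NormedAddCommGroup E] [InnerProductSpace ℝ E] [FiniteDimensional ℝ E]

/-- `ρ`, restricted to the open set `U ⊆ ℝᵐ`, is a smooth local parametrization of the subset
`M` of the Euclidean space `E`: a smooth immersion that maps `U` homeomorphically onto a
relatively open subset of `M`. -/
structure IsLocalParametrization {m : ℕ} (M : Set E) (U : Set (EuclideanSpace ℝ (Fin m)))
    (ρ : EuclideanSpace ℝ (Fin m) → E) : Prop where
  isOpen_source : IsOpen U
  smooth : ContDiffOn ℝ ∞ ρ U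
  immersion : ∀ u ∈ U, Function.Injective (fderiv ℝ ρ u)
  isEmbedding : Topology.IsEmbedding (U.domRestrict ρ)
  isOpen_image : ∃ O : Set E, IsOpen O ∧ ρ '' U = M ∩ O

/-- `M` is a smooth (embedded) submanifold of `E` of dimension `m`. -/
def IsSmoothSubmanifold (M : Set E) (m : ℕ) : Prop :=
  ∀ x ∈ M, ∃ (U : Set (EuclideanSpace ℝ (Fin m))) (ρ : EuclideanSpace ℝ (Fin m) → E),
    IsLocalParametrization M U ρ ∧ x ∈ ρ '' U

/-- The partial derivative `∂ᵢ ρ (u)`. -/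
def partialDeriv {m : ℕ} (ρ : EuclideanSpace ℝ (Fin m) → E) (i : Fin m)
    (u : EuclideanSpace ℝ (Fin m)) : E :=
  fderiv ℝ ρ u (EuclideanSpace.single i 1)

/-- The tangent space at `ρ u`: the span of the first order partial derivatives. -/
def tangentSpaceAt {m : ℕ} (ρ : EuclideanSpace ℝ (Fin m) → E)
    (u : EuclideanSpace ℝ (Fin m)) : Submodule ℝ E :=
  Submodule.span ℝ (Set.range fun i => partialDeriv ρ i u)

/-- The Gram matrix `⟨∂ᵢ ρ (u), ∂ⱼ ρ (u)⟩` of the induced metric. -/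
def gramMatrix {m : ℕ} (ρ : EuclideanSpace ℝ (Fin m) → E)
    (u : EuclideanSpace ℝ (Fin m)) : Matrix (Fin m) (Fin m) ℝ :=
  Matrix.of fun i j => inner ℝ (partialDeriv ρ i u) (partialDeriv ρ j u)

/-- The second fundamental form on coordinate vectors, `b(∂ᵢ ρ, ∂ⱼ ρ) = (∂ᵢ ∂ⱼ ρ (u))^⊥`:
the normal component of the second order partial derivative. -/
def secondFundamentalForm {m : ℕ} (ρ : EuclideanSpace ℝ (Fin m) → E)
    (u : EuclideanSpace ℝ (Fin m)) (i j : Fin m) : E :=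
  (tangentSpaceAt ρ u)ᗮ.starProjection (partialDeriv (partialDeriv ρ j) i u)

/-- The mean curvature vector `∑ᵢⱼ (G⁻¹)ᵢⱼ (∂ᵢ ∂ⱼ ρ (u))^⊥` at the point `ρ u`. -/
def meanCurvatureVector {m : ℕ} (ρ : EuclideanSpace ℝ (Fin m) → E)
    (u : EuclideanSpace ℝ (Fin m)) : E :=
  ∑ i, ∑ j, (gramMatrix ρ u)⁻¹ i j • secondFundamentalForm ρ u i j

/-- `M` is a minimal submanifold of `E` of dimension `m`: it is a smooth submanifold, and its
mean curvature vector vanishes at every point, in every local parametrization. -/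
def IsMinimalSubmanifold (M : Set E) (m : ℕ) : Prop :=
  IsSmoothSubmanifold M m ∧
    ∀ (U : Set (EuclideanSpace ℝ (Fin m))) (ρ : EuclideanSpace ℝ (Fin m) → E),
      IsLocalParametrization M U ρ → ∀ u ∈ U, meanCurvatureVector ρ u = 0

end Submanifolds

section Tensors

variable {d : ℕ}

/-- Real `n₁ × ⋯ × n_d` arrays `(t_{i₁ … i_d})` with the Frobenius inner product. -/
abbrev Tensor (n : Fin d → ℕ) : Type :=
  EuclideanSpace ℝ ((j : Fin d) → Fin (n j))

theorem frobenius_inner {n : Fin d → ℕ} (T S : Tensor n) :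
    inner ℝ T S = ∑ i, T i * S i := by
  simp [PiLp.inner_apply, mul_comm]

/-- The elementary tensor `v₁ ⊗ ⋯ ⊗ v_d`. -/
def pureTensor {n : Fin d → ℕ} (v : (j : Fin d) → EuclideanSpace ℝ (Fin (n j))) : Tensor n :=
  WithLp.toLp 2 fun i => ∏ j, v j (i j)

/-- The subspace `W₁ ⊗ ⋯ ⊗ W_d` of the space of tensors. -/
def tensorSubspace {n : Fin d → ℕ}
    (W : (j : Fin d) → Submodule ℝ (EuclideanSpace ℝ (Fin (n j)))) :
    Submodule ℝ (Tensor n) :=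
  Submodule.span ℝ {T | ∃ v : (j : Fin d) → EuclideanSpace ℝ (Fin (n j)),
    (∀ j, v j ∈ W j) ∧ T = pureTensor v}

/-- `T` has multilinear (Tucker) rank `r`: with respect to the componentwise order, `r` is the
minimum of the tuples `(dim W₁, …, dim W_d)` over all subspaces `W_j` with
`T ∈ W₁ ⊗ ⋯ ⊗ W_d`. -/
def HasMultilinearRank {n : Fin d → ℕ} (T : Tensor n) (r : Fin d → ℕ) : Prop :=
  IsLeast {s : Fin d → ℕ | ∃ W : (j : Fin d) → Submodule ℝ (EuclideanSpace ℝ (Fin (n j))),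
    (∀ j, Module.finrank ℝ (W j) = s j) ∧ T ∈ tensorSubspace W} r

/-- The set of tensors of format `n` and of multilinear rank `r`. -/
def tuckerManifold (n r : Fin d → ℕ) : Set (Tensor n) :=
  {T | HasMultilinearRank T r}

/-- A tensor of order two, regarded as a matrix. -/
def toMatrix {n : Fin 2 → ℕ} (T : Tensor n) : Matrix (Fin (n 0)) (Fin (n 1)) ℝ :=
  Matrix.of fun i j => T (Fin.cons i (Fin.cons j finZeroElim))

end Tensors

end TensorMinimality

end

noncomputable section

open Topology Filter

namespace TensorMinimality

/-! ### Lines in a submanifold and mean curvature -/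

section Submanifolds

variable {E : Type*} [NormedAddCommGroup E] [InnerProductSpace ℝ E]

/-! The mean curvature vector is the trace of the second fundamental form `b` over an orthonormal
tangent basis. If a straight segment through a point lies in `M`, its direction `v` satisfies `b(v,
v) = 0`. So a point where some orthonormal tangent basis consists of such directions has zero mean
curvature (`IsLocalParametrization.meanCurvatureVector_eq_zero`).

The Tucker manifold has such a basis everywhere. Write `T = (Q₁, …, Q_d) · C` with orthonormal
frames `Q j`, and let `Q' j` span the complements. Moving only the core, `C + t D`, or only one
factor, `Q j + t Q' j B`, traces a line by multilinearity, and the line keeps multilinear rank `r`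
for small `t`. The `d + 1` families of directions are mutually orthogonal because `(Q j)ᵀ * Q' j =
0`, and their dimensions `∏ r j` and `r j * (n j - r j)` add up to that of the manifold
(`exists_orthonormal_lines`).

For smoothness, multilinear rank is read off from the ranks of the flattenings
(`hasMultilinearRank_iff`); near `T` the factor subspaces are graphs over those of `T`, so the core
and the graph maps are coordinates. -/

/-- A smooth map with a smooth left inverse on an open set `O` parametrizes `M ∩ O`. -/
theorem isLocalParametrization_of_leftInverse {m : ℕ} {X : Type*} [NormedAddCommGroup X]
    [NormedSpace ℝ X] (e : EuclideanSpace ℝ (Fin m) ≃L[ℝ] X) {M O : Set E} {f : X → E}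
    {g : E → X} (hf : ContDiff ℝ ∞ f) (hO : IsOpen O) (hg : ContDiffOn ℝ ∞ g O)
    (hgf : ∀ y, f y ∈ O → g (f y) = y) (hM : ∀ y, f y ∈ O → f y ∈ M)
    (hfg : ∀ S ∈ M, S ∈ O → f (g S) = S) :
    IsLocalParametrization M ((f ∘ e) ⁻¹' O) (f ∘ e) := by
  have hsm : ContDiff ℝ ∞ (f ∘ e) := hf.comp e.contDiff
  have hopen : IsOpen ((f ∘ e) ⁻¹' O) := hO.preimage hsm.continuous
  refine ⟨hopen, hsm.contDiffOn, ?_, ?_, O, hO, ?_⟩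
  · intro u hu
    have hd : DifferentiableAt ℝ (f ∘ e) u := hsm.differentiable (by simp) u
    have hgd : DifferentiableAt ℝ g ((f ∘ e) u) :=
      (hg.contDiffAt (hO.mem_nhds hu)).differentiableAt (by simp)
    have hcomp := (hgd.hasFDerivAt.comp u hd.hasFDerivAt)
    have heq : g ∘ (f ∘ e) =ᶠ[𝓝 u] e := by
      filter_upwards [hopen.mem_nhds hu] with w hw
      exact hgf _ hw
    have h2 : HasFDerivAt e ((fderiv ℝ g ((f ∘ e) u)).comp (fderiv ℝ (f ∘ e) u)) u :=
      hcomp.congr_of_eventuallyEq heq.symm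
    have h3 := h2.unique e.hasFDerivAt
    intro a b hab
    apply e.injective
    have ha := DFunLike.congr_fun h3 a
    have hb := DFunLike.congr_fun h3 b
    simp only [ContinuousLinearMap.comp_apply, ContinuousLinearEquiv.coe_coe] at ha hb
    rw [← ha, ← hb, hab]
  · let f' : ((f ∘ e) ⁻¹' O) → O := fun u => ⟨f (e u), u.2⟩
    have hf' : Continuous f' :=
      Continuous.subtype_mk (hsm.continuous.comp continuous_subtype_val) _
    have hg' : Continuous (O.domRestrict g) :=
      continuousOn_iff_continuous_domRestrict.1 hg.continuousOn
    -- A continuous map is an embedding once its composite with a continuous map is one; here `g ∘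
    -- f'` is the restriction of `e`.
    have hemb : IsEmbedding f' := by
      refine IsEmbedding.of_comp hf' hg' ?_
      have : (O.domRestrict g) ∘ f' = e ∘ Subtype.val := by
        funext u
        exact hgf _ u.2
      rw [this]
      exact e.toHomeomorph.isEmbedding.comp IsEmbedding.subtypeVal
    exact IsEmbedding.subtypeVal.comp hemb
  · ext S
    constructor
    · rintro ⟨u, hu, rfl⟩
      exact ⟨hM _ hu, hu⟩
    · rintro ⟨hS, hSO⟩
      have h : (f ∘ e) (e.symm (g S)) = S := by simpa using hfg S hS hSO
      exact ⟨e.symm (g S), by rw [Set.mem_preimage, h]; exact hSO, h⟩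

theorem fderiv_mem_tangentSpaceAt {m : ℕ} (ρ : EuclideanSpace ℝ (Fin m) → E)
    (u a : EuclideanSpace ℝ (Fin m)) : fderiv ℝ ρ u a ∈ tangentSpaceAt ρ u := by
  have ha : a = ∑ i, a i • EuclideanSpace.single i (1 : ℝ) := by
    simpa using ((EuclideanSpace.basisFun (Fin m) ℝ).sum_repr a).symm
  rw [ha, map_sum]
  refine Submodule.sum_mem _ fun i _ => ?_
  rw [map_smul]
  exact Submodule.smul_mem _ _ (Submodule.subset_span ⟨i, rfl⟩)

variable [FiniteDimensional ℝ E]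

/-- A line segment in `M` through `ρ u` lifts to a smooth curve in the parameter domain. -/
theorem IsLocalParametrization.exists_lift_line {m : ℕ} {M : Set E}
    {U : Set (EuclideanSpace ℝ (Fin m))} {ρ : EuclideanSpace ℝ (Fin m) → E}
    (h : IsLocalParametrization M U ρ) {u : EuclideanSpace ℝ (Fin m)} (hu : u ∈ U) {v : E}
    (hv : ∀ᶠ t in 𝓝 (0 : ℝ), ρ u + t • v ∈ M) :
    ∃ γ : ℝ → EuclideanSpace ℝ (Fin m), ContDiffAt ℝ ∞ γ 0 ∧ γ 0 = u ∧
      ∀ᶠ t in 𝓝 (0 : ℝ), ρ (γ t) = ρ u + t • v := by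
  -- With `g` a linear left inverse of `dρ(u)`, the map `g ∘ ρ` has derivative the identity at `u`.
  -- Its local inverse `φ` makes `φ ∘ g` a smooth left inverse of `ρ` near `u`, defined on a
  -- neighbourhood in `E`.
  obtain ⟨g₀, hg₀⟩ := LinearMap.exists_leftInverse_of_injective
    (fderiv ℝ ρ u : EuclideanSpace ℝ (Fin m) →ₗ[ℝ] E)
    (LinearMap.ker_eq_bot.2 (h.immersion u hu))
  let g : E →L[ℝ] EuclideanSpace ℝ (Fin m) := LinearMap.toContinuousLinearMap g₀
  have hρ : ContDiffAt ℝ ∞ ρ u := h.smooth.contDiffAt (h.isOpen_source.mem_nhds hu)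
  have hF : ContDiffAt ℝ ∞ (fun w => g (ρ w)) u := g.contDiff.contDiffAt.comp u hρ
  have hF' : HasFDerivAt (fun w => g (ρ w))
      (ContinuousLinearEquiv.refl ℝ (EuclideanSpace ℝ (Fin m)) :
        EuclideanSpace ℝ (Fin m) →L[ℝ] EuclideanSpace ℝ (Fin m)) u := by
    have h1 := g.hasFDerivAt.comp u (hρ.differentiableAt (by simp)).hasFDerivAt
    convert! h1 using 1
    ext a : 1
    exact (DFunLike.congr_fun hg₀ a).symm
  let φ := hF.localInverse hF' (by simp)
  have hφ : ContDiffAt ℝ ∞ φ (g (ρ u)) := hF.to_localInverse hF' (by simp)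
  have hφu : φ (g (ρ u)) = u := hF.localInverse_apply_image hF' (by simp)
  have hleft : ∀ᶠ w in 𝓝 u, φ (g (ρ w)) = w :=
    (hF.hasStrictFDerivAt' hF' (by simp)).eventually_left_inverse
  have hline : Continuous fun t : ℝ => ρ u + t • v := by fun_prop
  have hline0 : Tendsto (fun t : ℝ => ρ u + t • v) (𝓝 0) (𝓝 (ρ u)) := by
    simpa using hline.tendsto 0
  obtain ⟨O, hO, hUO⟩ := h.isOpen_image
  have huO : ρ u ∈ O := by
    have : ρ u ∈ M ∩ O := hUO ▸ Set.mem_image_of_mem ρ hu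
    exact this.2
  -- The embedding property enters here: points of `ρ '' U` close to `ρ u` in `E` have parameters
  -- close to `u`, where `φ ∘ g` inverts `ρ`.
  have hnear : {w : U | φ (g (ρ w)) = w} ∈ 𝓝 (⟨u, hu⟩ : U) :=
    (continuous_subtype_val.tendsto (⟨u, hu⟩ : U)).eventually hleft
  rw [h.isEmbedding.nhds_eq_comap] at hnear
  obtain ⟨V, hV, hVsub⟩ := Filter.mem_comap.1 hnear
  have hV' : V ∈ 𝓝 (ρ u) := hV
  refine ⟨fun t => φ (g (ρ u + t • v)), ?_, by simpa using hφu, ?_⟩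
  · have h1 : ContDiffAt ℝ ∞ (fun t : ℝ => g (ρ u + t • v)) 0 := by fun_prop
    refine ContDiffAt.comp (0 : ℝ) (g := φ) ?_ h1
    simpa using hφ
  · filter_upwards [hv, hline0.eventually hV', hline0.eventually (hO.mem_nhds huO)]
      with t htM htV htO
    have : ρ u + t • v ∈ ρ '' U := hUO ▸ ⟨htM, htO⟩
    obtain ⟨w, hw, hwt⟩ := this
    have hw' : φ (g (ρ w)) = w :=
      @hVsub ⟨w, hw⟩ (by
        change ρ w ∈ V
        rw [hwt]
        exact htV)
    rw [← hwt, hw']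

/-- The second derivative in a direction along which `M` contains a line is tangential. -/
theorem IsLocalParametrization.exists_asymptotic {m : ℕ} {M : Set E}
    {U : Set (EuclideanSpace ℝ (Fin m))} {ρ : EuclideanSpace ℝ (Fin m) → E}
    (h : IsLocalParametrization M U ρ) {u : EuclideanSpace ℝ (Fin m)} (hu : u ∈ U) {v : E}
    (hv : ∀ᶠ t in 𝓝 (0 : ℝ), ρ u + t • v ∈ M) :
    ∃ a, fderiv ℝ ρ u a = v ∧ fderiv ℝ (fderiv ℝ ρ) u a a ∈ tangentSpaceAt ρ u := by
  obtain ⟨γ, hγ, hγ0, hργ⟩ := h.exists_lift_line hu hv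
  have hUu : U ∈ 𝓝 u := h.isOpen_source.mem_nhds hu
  have hρ : ContDiffAt ℝ ∞ ρ u := h.smooth.contDiffAt hUu
  have hγU : ∀ᶠ t in 𝓝 (0 : ℝ), γ t ∈ U := by
    have := hγ.continuousAt
    rw [ContinuousAt, hγ0] at this
    exact this.eventually hUu
  have hγd : ∀ᶠ t in 𝓝 (0 : ℝ), DifferentiableAt ℝ γ t := by
    filter_upwards [(hγ.of_le (m := 1) (by norm_cast)).eventually (by simp)] with t ht
    exact ht.differentiableAt (by simp)
  have hfirst : ∀ᶠ t in 𝓝 (0 : ℝ), fderiv ℝ ρ (γ t) (deriv γ t) = v := by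
    filter_upwards [hγU, hγd, hργ.eventually_nhds] with t htU htd hteq
    have h1 : HasFDerivAt ρ (fderiv ℝ ρ (γ t)) (γ t) :=
      ((h.smooth.contDiffAt (h.isOpen_source.mem_nhds htU)).differentiableAt
        (by simp)).hasFDerivAt
    have h2 := h1.comp_hasDerivAt t htd.hasDerivAt
    have h3 : HasDerivAt (ρ ∘ γ) v t := by
      have h4 : HasDerivAt (fun t : ℝ => ρ u + t • v) v t := by
        simpa using ((hasDerivAt_id t).smul_const v).const_add (ρ u)
      exact h4.congr_of_eventuallyEq hteq
    exact h2.unique h3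
  have hd1 : HasFDerivAt (fderiv ℝ ρ) (fderiv ℝ (fderiv ℝ ρ) u) (γ 0) := by
    rw [hγ0]
    exact ((hρ.fderiv_right (m := 1) (by norm_cast)).differentiableAt (by simp)).hasFDerivAt
  have hd2 : HasDerivAt (fun t => fderiv ℝ ρ (γ t)) (fderiv ℝ (fderiv ℝ ρ) u (deriv γ 0)) 0 :=
    hd1.comp_hasDerivAt (0 : ℝ) hγd.self_of_nhds.hasDerivAt
  have hd3 : HasDerivAt (deriv γ) (deriv (deriv γ) 0) 0 :=
    DifferentiableAt.hasDerivAt <| by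
      have h1 : DifferentiableAt ℝ (fderiv ℝ γ) 0 :=
        (hγ.fderiv_right (m := 1) (by norm_cast)).differentiableAt (by simp)
      exact h1.clm_apply (differentiableAt_const (1 : ℝ))
  -- Second derivative of `ρ ∘ γ` at `0`: `D²ρ(γ', γ') + Dρ(γ'')`. It vanishes since `ρ ∘ γ` is
  -- affine, so the first summand is tangential.
  have hd4 := hd2.clm_apply hd3
  have hd5 : HasDerivAt (fun t => fderiv ℝ ρ (γ t) (deriv γ t)) 0 0 :=
    (hasDerivAt_const (0 : ℝ) v).congr_of_eventuallyEq hfirst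
  have hd6 := hd4.unique hd5
  refine ⟨deriv γ 0, ?_, ?_⟩
  · simpa [hγ0] using hfirst.self_of_nhds
  · rw [hγ0] at hd6
    rw [eq_neg_of_add_eq_zero_left hd6]
    exact Submodule.neg_mem _ (fderiv_mem_tangentSpaceAt ρ u _)

/-- If `m = dim M` orthonormal directions at `ρ u` are directions of line segments in `M`, then
the mean curvature vector vanishes at `ρ u`. -/
theorem IsLocalParametrization.meanCurvatureVector_eq_zero {m : ℕ} {M : Set E}
    {U : Set (EuclideanSpace ℝ (Fin m))} {ρ : EuclideanSpace ℝ (Fin m) → E}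
    (h : IsLocalParametrization M U ρ) {u : EuclideanSpace ℝ (Fin m)} (hu : u ∈ U)
    {v : Fin m → E} (hv : Orthonormal ℝ v)
    (hline : ∀ k, ∀ᶠ t in 𝓝 (0 : ℝ), ρ u + t • v k ∈ M) :
    meanCurvatureVector ρ u = 0 := by
  choose a ha hb using fun k => h.exists_asymptotic hu (hline k)
  have hρ : ContDiffAt ℝ ∞ ρ u := h.smooth.contDiffAt (h.isOpen_source.mem_nhds hu)
  have hdd : DifferentiableAt ℝ (fderiv ℝ ρ) u :=
    (hρ.fderiv_right (m := 1) (by norm_cast)).differentiableAt (by simp)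
  have hexp : ∀ k, a k = ∑ i, a k i • EuclideanSpace.single i (1 : ℝ) := fun k => by
    simpa using ((EuclideanSpace.basisFun (Fin m) ℝ).sum_repr (a k)).symm
  have hsecond : ∀ i j, partialDeriv (partialDeriv ρ j) i u =
      fderiv ℝ (fderiv ℝ ρ) u (EuclideanSpace.single i 1) (EuclideanSpace.single j 1) := by
    intro i j
    have h1 := (hdd.hasFDerivAt.clm_apply
      (hasFDerivAt_const (EuclideanSpace.single j (1 : ℝ)) u)).fderiv
    change fderiv ℝ (fun w => fderiv ℝ ρ w (EuclideanSpace.single j 1)) u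
      (EuclideanSpace.single i 1) = _
    rw [h1]
    simp
  -- The columns of `A` are the coordinates of the orthonormal vectors `v k`, so `Aᵀ G A = 1` and
  -- `G⁻¹ = A Aᵀ`. This turns the mean curvature into `∑ₖ b(v k, v k)`.
  let A : Matrix (Fin m) (Fin m) ℝ := Matrix.of fun i k => a k i
  have hAGA : A.transpose * (gramMatrix ρ u * A) = 1 := by
    ext k l
    have h1 : inner ℝ (v k) (v l) = (1 : Matrix (Fin m) (Fin m) ℝ) k l := by
      rw [Matrix.one_apply]
      exact orthonormal_iff_ite.1 hv k l
    rw [← h1, ← ha k, ← ha l]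
    conv_rhs => rw [hexp k, hexp l]
    simp only [map_sum, map_smul, sum_inner, inner_sum, inner_smul_left, inner_smul_right]
    simp [Matrix.mul_apply, A, gramMatrix, partialDeriv, Finset.mul_sum]
    rw [Finset.sum_comm]
    refine Finset.sum_congr rfl fun i _ => Finset.sum_congr rfl fun j _ => ?_
    ring
  have hinv : (gramMatrix ρ u)⁻¹ = A * A.transpose := by
    apply Matrix.inv_eq_right_inv
    rw [← Matrix.mul_assoc]
    exact mul_eq_one_comm.1 hAGA
  let N : E →L[ℝ] E := (tangentSpaceAt ρ u)ᗮ.starProjection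
  have hN : ∀ k, N (fderiv ℝ (fderiv ℝ ρ) u (a k) (a k)) = 0 := fun k =>
    Submodule.starProjection_orthogonal_apply_eq_zero (hb k)
  have hk : ∀ k, ∑ i, ∑ j, (a k i * a k j) • secondFundamentalForm ρ u i j = 0 := by
    intro k
    rw [← hN k]
    conv_rhs => rw [hexp k]
    simp only [map_sum, map_smul, sum_apply, smul_apply]
    simp only [secondFundamentalForm, hsecond, Finset.smul_sum, smul_smul, N]
    rw [Finset.sum_comm]
    refine Finset.sum_congr rfl fun i _ => Finset.sum_congr rfl fun j _ => ?_
    rw [mul_comm]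
  unfold meanCurvatureVector
  rw [hinv]
  simp only [Matrix.mul_apply, Matrix.transpose_apply, A, Matrix.of_apply, Finset.sum_smul]
  refine (Finset.sum_congr rfl fun i _ => Finset.sum_comm).trans ?_
  rw [Finset.sum_comm]
  exact Finset.sum_eq_zero fun k _ => hk k

end Submanifolds

/-! ### Column spaces and orthonormal frames -/

section Matrices

open Matrix

/-- A matrix `M` factors through `M * L` if both have the same rank. -/
theorem exists_eq_mul_mul_of_rank_le {m ι κ : Type*} [Fintype m] [Fintype ι] [Fintype κ]
    [DecidableEq ι] (M : Matrix m ι ℝ) (L : Matrix ι κ ℝ) (h : M.rank ≤ (M * L).rank) :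
    ∃ G : Matrix κ ι ℝ, M = M * L * G := by
  have hle : LinearMap.range (M * L).mulVecLin ≤ LinearMap.range M.mulVecLin := by
    rw [Matrix.mulVecLin_mul]
    exact LinearMap.range_comp_le_range _ _
  -- Equal column spaces: every column of `M` is a combination of columns of `M * L`.
  have heq := Submodule.eq_of_le_of_finrank_le hle h
  have hcol : ∀ i, ∃ g : κ → ℝ, (M * L) *ᵥ g = M.col i := by
    intro i
    have : M.col i ∈ LinearMap.range M.mulVecLin := ⟨Pi.single i 1, by simp⟩
    rw [← heq] at this
    exact this
  choose g hg using hcol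
  refine ⟨Matrix.of fun k i => g i k, ?_⟩
  ext a i
  exact (congrFun (hg i) a).symm

/-- Orthonormal frames of a subspace and of its orthogonal complement. -/
theorem exists_orthonormal_frames {n r : ℕ} (W : Submodule ℝ (EuclideanSpace ℝ (Fin n)))
    (hW : Module.finrank ℝ W = r) :
    ∃ (Q : Matrix (Fin n) (Fin r) ℝ) (Q' : Matrix (Fin n) (Fin (n - r)) ℝ),
      Qᵀ * Q = 1 ∧ Q'ᵀ * Q' = 1 ∧ Qᵀ * Q' = 0 ∧ Q'ᵀ * Q = 0 ∧ Q * Qᵀ + Q' * Q'ᵀ = 1 ∧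
      (∀ k, WithLp.toLp 2 (Q.col k) ∈ W) ∧ ∀ v ∈ W, ∃ c, Q *ᵥ c = v.ofLp := by
  have hrn : r ≤ n := by
    have := Submodule.finrank_le W
    rw [hW] at this
    simpa using this
  have hW' : Module.finrank ℝ Wᗮ = n - r := by
    have := Submodule.finrank_add_finrank_orthogonal W
    rw [hW] at this
    simp at this
    omega
  let b : OrthonormalBasis (Fin r) ℝ W := (stdOrthonormalBasis ℝ W).reindex (finCongr hW)
  let c : OrthonormalBasis (Fin (n - r)) ℝ Wᗮ :=
    (stdOrthonormalBasis ℝ Wᗮ).reindex (finCongr hW')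
  let Q : Matrix (Fin n) (Fin r) ℝ := Matrix.of fun a k => (b k : EuclideanSpace ℝ (Fin n)) a
  let Q' : Matrix (Fin n) (Fin (n - r)) ℝ :=
    Matrix.of fun a k => (c k : EuclideanSpace ℝ (Fin n)) a
  have inner_eq : ∀ x y : EuclideanSpace ℝ (Fin n), inner ℝ x y = ∑ a, x a * y a := by
    intro x y
    simp [PiLp.inner_apply, mul_comm]
  have h1 : Qᵀ * Q = 1 := by
    ext k l
    have := orthonormal_iff_ite.1 b.orthonormal k l
    rw [Submodule.coe_inner, inner_eq] at this
    simpa [Matrix.mul_apply, Q, Matrix.one_apply] using this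
  have h2 : Q'ᵀ * Q' = 1 := by
    ext k l
    have := orthonormal_iff_ite.1 c.orthonormal k l
    rw [Submodule.coe_inner, inner_eq] at this
    simpa [Matrix.mul_apply, Q', Matrix.one_apply] using this
  have h3 : Qᵀ * Q' = 0 := by
    ext k l
    have := Submodule.inner_right_of_mem_orthogonal (b k).2 (c l).2
    rw [inner_eq] at this
    simpa [Matrix.mul_apply, Q', Q] using this
  have h4 : Q'ᵀ * Q = 0 := by
    have := congrArg Matrix.transpose h3
    simpa using this
  refine ⟨Q, Q', h1, h2, h3, h4, ?_, fun k => (b k).2, ?_⟩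
  -- The block matrix `[Q Q']` is square because `r ≤ n`, so its left inverse is also a right
  -- inverse.
  · have e : Fin r ⊕ Fin (n - r) ≃ Fin n :=
      finSumFinEquiv.trans (finCongr (by omega))
    have h5 : fromRows Qᵀ Q'ᵀ * fromCols Q Q' = 1 := by
      rw [fromRows_mul_fromCols, h1, h2, h3, h4, fromBlocks_one]
    have h6 := (Matrix.mul_eq_one_comm_of_equiv e).1 h5
    rwa [fromCols_mul_fromRows] at h6
  · intro v hv
    refine ⟨fun k => b.repr ⟨v, hv⟩ k, ?_⟩
    have h5 := congrArg (Subtype.val) (b.sum_repr ⟨v, hv⟩)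
    simp only at h5
    ext a
    conv_rhs => rw [← h5]
    simp [Matrix.mulVec, dotProduct, Q, mul_comm]

/-- The column space of a matrix, as a subspace of Euclidean space. -/
def colSpace {n : ℕ} {ι : Type*} (M : Matrix (Fin n) ι ℝ) :
    Submodule ℝ (EuclideanSpace ℝ (Fin n)) :=
  Submodule.span ℝ (Set.range fun i => WithLp.toLp 2 (M.col i))

theorem toLp_col_mem_colSpace {n : ℕ} {ι : Type*} (M : Matrix (Fin n) ι ℝ) (i : ι) :
    WithLp.toLp 2 (M.col i) ∈ colSpace M :=
  Submodule.subset_span ⟨i, rfl⟩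

theorem colSpace_eq_map {n : ℕ} {ι : Type*} (M : Matrix (Fin n) ι ℝ) :
    colSpace M = (Submodule.span ℝ (Set.range M.col)).map
      ((WithLp.linearEquiv 2 ℝ (Fin n → ℝ)).symm : (Fin n → ℝ) →ₗ[ℝ] EuclideanSpace ℝ (Fin n)) := by
  rw [Submodule.map_span, ← Set.range_comp]
  rfl

theorem finrank_colSpace {n : ℕ} {ι : Type*} [Fintype ι] (M : Matrix (Fin n) ι ℝ) :
    Module.finrank ℝ (colSpace M) = M.rank := by
  rw [colSpace_eq_map, Matrix.rank_eq_finrank_span_cols]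
  exact LinearEquiv.finrank_map_eq _ _

theorem exists_mulVec_eq_of_mem_colSpace {n : ℕ} {ι : Type*} [Fintype ι]
    (M : Matrix (Fin n) ι ℝ) {v : EuclideanSpace ℝ (Fin n)} (hv : v ∈ colSpace M) :
    ∃ c, M *ᵥ c = v.ofLp := by
  rw [colSpace_eq_map] at hv
  obtain ⟨w, hw, rfl⟩ := hv
  rw [← Matrix.range_mulVecLin] at hw
  exact hw

/-- Orthonormal frames adapted to the column space of a matrix of rank `r`. -/
theorem exists_frames_of_rank_eq {n r : ℕ} {ι : Type*} [Fintype ι] (M : Matrix (Fin n) ι ℝ)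
    (hM : M.rank = r) :
    ∃ (Q : Matrix (Fin n) (Fin r) ℝ) (Q' : Matrix (Fin n) (Fin (n - r)) ℝ)
      (L : Matrix ι (Fin r) ℝ),
      Qᵀ * Q = 1 ∧ Q'ᵀ * Q' = 1 ∧ Qᵀ * Q' = 0 ∧ Q'ᵀ * Q = 0 ∧ Q * Qᵀ + Q' * Q'ᵀ = 1 ∧
      (∀ k, WithLp.toLp 2 (Q.col k) ∈ colSpace M) ∧ M * L = Q ∧ Q * Qᵀ * M = M := by
  obtain ⟨Q, Q', h1, h2, h3, h4, h5, h6, h7⟩ :=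
    exists_orthonormal_frames (colSpace M) ((finrank_colSpace M).trans hM)
  choose l hl using fun k => exists_mulVec_eq_of_mem_colSpace M (h6 k)
  choose c hc using fun i => h7 _ (toLp_col_mem_colSpace M i)
  refine ⟨Q, Q', Matrix.of fun i k => l k i, h1, h2, h3, h4, h5, h6, ?_, ?_⟩
  · ext a k
    exact congrFun (hl k) a
  · have : M = Q * Matrix.of fun k i => c i k := by
      ext a i
      exact (congrFun (hc i) a).symm
    rw [this, Matrix.mul_assoc, ← Matrix.mul_assoc Qᵀ, h1, Matrix.one_mul]

end Matrices

/-! ### Multilinear multiplication, flattenings and multilinear rank -/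

section Tensors

open Matrix

variable {d : ℕ} {n r s : Fin d → ℕ}

/-- The multilinear multiplication `(A₁, …, A_d) · C`. -/
def mulTensor (A : (j : Fin d) → Matrix (Fin (n j)) (Fin (r j)) ℝ) : Tensor r →ₗ[ℝ] Tensor n where
  toFun C := WithLp.toLp 2 fun i => ∑ k, (∏ j, A j (i j) (k j)) * C k
  map_add' C D := by
    ext i
    simp [mul_add, Finset.sum_add_distrib]
  map_smul' t C := by
    ext i
    simp [Finset.mul_sum, mul_left_comm]

theorem mulTensor_apply (A : (j : Fin d) → Matrix (Fin (n j)) (Fin (r j)) ℝ) (C : Tensor r)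
    (i : (j : Fin d) → Fin (n j)) :
    mulTensor A C i = ∑ k, (∏ j, A j (i j) (k j)) * C k := rfl

theorem mulTensor_mulTensor (A : (j : Fin d) → Matrix (Fin (n j)) (Fin (r j)) ℝ)
    (B : (j : Fin d) → Matrix (Fin (r j)) (Fin (s j)) ℝ) (C : Tensor s) :
    mulTensor A (mulTensor B C) = mulTensor (fun j => A j * B j) C := by
  ext i
  simp only [mulTensor_apply, Matrix.mul_apply, Finset.mul_sum]
  rw [Finset.sum_comm]
  refine Finset.sum_congr rfl fun l _ => ?_
  rw [Finset.prod_univ_sum, Fintype.piFinset_univ, Finset.sum_mul]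
  refine Finset.sum_congr rfl fun k _ => ?_
  rw [Finset.prod_mul_distrib, mul_assoc]

theorem mulTensor_one (C : Tensor n) :
    mulTensor (fun j => (1 : Matrix (Fin (n j)) (Fin (n j)) ℝ)) C = C := by
  ext i
  rw [mulTensor_apply, Finset.sum_eq_single i]
  · simp
  · intro k _ hk
    obtain ⟨j, hj⟩ := Function.ne_iff.1 hk
    have h0 := Finset.prod_eq_zero
      (f := fun l => (1 : Matrix (Fin (n l)) (Fin (n l)) ℝ) (i l) (k l))
      (Finset.mem_univ j) (Matrix.one_apply_ne (Ne.symm hj))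
    rw [h0, zero_mul]
  · simp

theorem mulTensor_eq_zero (A : (j : Fin d) → Matrix (Fin (n j)) (Fin (r j)) ℝ) (C : Tensor r)
    {j : Fin d} (hj : A j = 0) : mulTensor A C = 0 := by
  ext i
  rw [mulTensor_apply]
  refine Finset.sum_eq_zero fun k _ => ?_
  rw [Finset.prod_eq_zero (Finset.mem_univ j) (by simp [hj]), zero_mul]

theorem prod_update_apply (A : (j : Fin d) → Matrix (Fin (n j)) (Fin (r j)) ℝ) (j : Fin d)
    (X : Matrix (Fin (n j)) (Fin (r j)) ℝ) (i : (j : Fin d) → Fin (n j))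
    (k : (j : Fin d) → Fin (r j)) :
    ∏ l, Function.update A j X l (i l) (k l) =
      X (i j) (k j) * ∏ l ∈ Finset.univ.erase j, A l (i l) (k l) := by
  rw [← Finset.mul_prod_erase _ _ (Finset.mem_univ j), Function.update_self]
  congr 1
  refine Finset.prod_congr rfl fun l hl => ?_
  rw [Function.update_of_ne (Finset.ne_of_mem_erase hl)]

/-- Multilinear multiplication as a linear function of its `j`-th matrix. -/
def mulTensorSlot (A : (j : Fin d) → Matrix (Fin (n j)) (Fin (r j)) ℝ) (C : Tensor r)
    (j : Fin d) : Matrix (Fin (n j)) (Fin (r j)) ℝ →ₗ[ℝ] Tensor n where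
  toFun X := mulTensor (Function.update A j X) C
  map_add' X Y := by
    ext i
    simp [mulTensor_apply, prod_update_apply, add_mul, Finset.sum_add_distrib]
  map_smul' t X := by
    ext i
    simp [mulTensor_apply, prod_update_apply, Finset.mul_sum, mul_assoc]

theorem mulTensorSlot_apply (A : (j : Fin d) → Matrix (Fin (n j)) (Fin (r j)) ℝ) (C : Tensor r)
    (j : Fin d) (X : Matrix (Fin (n j)) (Fin (r j)) ℝ) :
    mulTensorSlot A C j X = mulTensor (Function.update A j X) C := rfl

theorem mulTensorSlot_self (A : (j : Fin d) → Matrix (Fin (n j)) (Fin (r j)) ℝ) (C : Tensor r)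
    (j : Fin d) : mulTensorSlot A C j (A j) = mulTensor A C := by
  rw [mulTensorSlot_apply, Function.update_eq_self]

/-- The adjoint is multiplication by the transposes. Hence a single slot with `(A j)ᵀ * B j = 0`
forces orthogonality. -/
theorem inner_mulTensor_mulTensor (A : (j : Fin d) → Matrix (Fin (n j)) (Fin (r j)) ℝ)
    (B : (j : Fin d) → Matrix (Fin (n j)) (Fin (s j)) ℝ) (C : Tensor r) (D : Tensor s) :
    inner ℝ (mulTensor A C) (mulTensor B D) =
      inner ℝ C (mulTensor (fun j => (A j)ᵀ * B j) D) := by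
  rw [← mulTensor_mulTensor, frobenius_inner, frobenius_inner]
  generalize mulTensor B D = S
  simp only [mulTensor_apply, Finset.sum_mul, Finset.mul_sum, Matrix.transpose_apply]
  rw [Finset.sum_comm]
  refine Finset.sum_congr rfl fun k _ => Finset.sum_congr rfl fun i _ => ?_
  ring

/-- The `j`-th flattening of a tensor. Its columns are the `j`-th fibres; the column index runs
over all multi-indices, and its `j`-th entry is irrelevant. -/
def flatten (j : Fin d) (T : Tensor n) : Matrix (Fin (n j)) ((j : Fin d) → Fin (n j)) ℝ :=
  Matrix.of fun a i => T (Function.update i j a)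

/-- The right factor of the `j`-th flattening of `mulTensor A C`. -/
def flattenFactor (j : Fin d) (A : (j : Fin d) → Matrix (Fin (n j)) (Fin (r j)) ℝ)
    (C : Tensor r) : Matrix (Fin (r j)) ((j : Fin d) → Fin (n j)) ℝ :=
  Matrix.of fun b i =>
    ∑ k, if k j = b then (∏ l ∈ Finset.univ.erase j, A l (i l) (k l)) * C k else 0

/-- `flattenFactor j A C` does not involve `A j`, so changing the `j`-th matrix changes only the
left factor. -/
theorem flatten_mulTensorSlot (A : (j : Fin d) → Matrix (Fin (n j)) (Fin (r j)) ℝ) (C : Tensor r)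
    (j : Fin d) (X : Matrix (Fin (n j)) (Fin (r j)) ℝ) :
    flatten j (mulTensorSlot A C j X) = X * flattenFactor j A C := by
  ext a i
  simp only [flatten, flattenFactor, Matrix.of_apply, mulTensorSlot_apply, mulTensor_apply,
    prod_update_apply, Matrix.mul_apply, Finset.mul_sum, mul_ite, mul_zero]
  rw [Finset.sum_comm]
  refine Finset.sum_congr rfl fun k _ => ?_
  rw [Finset.sum_ite_eq, if_pos (Finset.mem_univ _), Function.update_self, mul_assoc]
  congr 2
  refine Finset.prod_congr rfl fun l hl => ?_
  rw [Function.update_of_ne (Finset.ne_of_mem_erase hl)]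

theorem flatten_mulTensor (A : (j : Fin d) → Matrix (Fin (n j)) (Fin (r j)) ℝ) (C : Tensor r)
    (j : Fin d) : flatten j (mulTensor A C) = A j * flattenFactor j A C := by
  rw [← mulTensorSlot_self A C j, flatten_mulTensorSlot]

theorem mulTensor_update_one_apply (j : Fin d) (B : Matrix (Fin (n j)) (Fin (n j)) ℝ)
    (T : Tensor n) (i : (j : Fin d) → Fin (n j)) :
    mulTensor (Function.update (fun l => (1 : Matrix (Fin (n l)) (Fin (n l)) ℝ)) j B) T i =
      (B * flatten j T) (i j) i := by
  rw [mulTensor_apply, Matrix.mul_apply]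
  symm
  -- The identity matrices kill every multi-index that differs from `i` outside slot `j`.
  refine Fintype.sum_of_injective (Function.update i j) (Function.update_injective i j) _ _ ?_ ?_
  · intro k hk
    rw [prod_update_apply]
    obtain ⟨l, hlj, hl⟩ : ∃ l, l ≠ j ∧ i l ≠ k l := by
      by_contra! hcon
      refine hk ⟨k j, ?_⟩
      ext1 l
      by_cases hl : l = j
      · subst hl
        simp
      · rw [Function.update_of_ne hl, hcon l hl]
    have h0 := Finset.prod_eq_zero
      (f := fun l => (1 : Matrix (Fin (n l)) (Fin (n l)) ℝ) (i l) (k l))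
      (Finset.mem_erase.2 ⟨hlj, Finset.mem_univ l⟩) (Matrix.one_apply_ne hl)
    rw [h0, mul_zero, zero_mul]
  · intro b
    rw [prod_update_apply, Function.update_self, Finset.prod_eq_one, mul_one]
    · rfl
    · intro l hl
      rw [Function.update_of_ne (Finset.ne_of_mem_erase hl), Matrix.one_apply_eq]

theorem mulTensor_update_one_eq_self (j : Fin d) {B : Matrix (Fin (n j)) (Fin (n j)) ℝ}
    {T : Tensor n} (h : B * flatten j T = flatten j T) :
    mulTensor (Function.update (fun l => (1 : Matrix (Fin (n l)) (Fin (n l)) ℝ)) j B) T = T := by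
  ext i
  rw [mulTensor_update_one_apply, h]
  simp [flatten]

/-- Matrices that fix all flattenings of a tensor fix the tensor. -/
theorem mulTensor_eq_self {B : (j : Fin d) → Matrix (Fin (n j)) (Fin (n j)) ℝ} {T : Tensor n}
    (h : ∀ j, B j * flatten j T = flatten j T) : mulTensor B T = T := by
  -- The matrices are applied one slot at a time.
  have key : ∀ t : Finset (Fin d), mulTensor (fun j => if j ∈ t then B j else 1) T = T := by
    intro t
    induction t using Finset.induction_on with
    | empty => simpa using mulTensor_one T
    | insert a t ha ih =>
      have hfun : (fun j => if j ∈ insert a t then B j else 1) = fun j =>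
          Function.update (fun l => (1 : Matrix (Fin (n l)) (Fin (n l)) ℝ)) a (B a) j *
            (if j ∈ t then B j else 1) := by
        funext j
        by_cases hj : j = a
        · subst hj
          simp [ha]
        · simp [hj]
      rw [hfun, ← mulTensor_mulTensor, ih, mulTensor_update_one_eq_self a (h a)]
  simpa using key Finset.univ

theorem mulTensor_mem_tensorSubspace {A : (j : Fin d) → Matrix (Fin (n j)) (Fin (r j)) ℝ}
    {W : (j : Fin d) → Submodule ℝ (EuclideanSpace ℝ (Fin (n j)))}
    (h : ∀ j k, WithLp.toLp 2 ((A j).col k) ∈ W j) (C : Tensor r) :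
    mulTensor A C ∈ tensorSubspace W := by
  have : mulTensor A C = ∑ k, C k • pureTensor fun j => WithLp.toLp 2 ((A j).col (k j)) := by
    ext i
    simp [mulTensor_apply, pureTensor, mul_comm]
  rw [this]
  exact Submodule.sum_mem _ fun k _ => Submodule.smul_mem _ _
    (Submodule.subset_span ⟨_, fun j => h j (k j), rfl⟩)

/-- Every `j`-th fibre of `v₁ ⊗ ⋯ ⊗ v_d` is a multiple of `v j`; the rest is linearity. -/
theorem flatten_col_mem {W : (j : Fin d) → Submodule ℝ (EuclideanSpace ℝ (Fin (n j)))}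
    {T : Tensor n} (hT : T ∈ tensorSubspace W) (j : Fin d) (i : (j : Fin d) → Fin (n j)) :
    WithLp.toLp 2 ((flatten j T).col i) ∈ W j := by
  induction hT using Submodule.span_induction with
  | mem T hT =>
    obtain ⟨v, hv, rfl⟩ := hT
    have : WithLp.toLp 2 ((flatten j (pureTensor v)).col i) =
        (∏ l ∈ Finset.univ.erase j, v l (i l)) • v j := by
      ext a
      simp only [flatten, pureTensor, Matrix.col_apply, Matrix.of_apply, PiLp.smul_apply,
        smul_eq_mul]
      rw [← Finset.mul_prod_erase _ _ (Finset.mem_univ j), Function.update_self, mul_comm]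
      congr 1
      refine Finset.prod_congr rfl fun l hl => ?_
      rw [Function.update_of_ne (Finset.ne_of_mem_erase hl)]
    rw [this]
    exact Submodule.smul_mem _ _ (hv j)
  | zero => exact (W j).zero_mem
  | add S T _ _ hS hT => exact (W j).add_mem hS hT
  | smul t T _ hT => exact (W j).smul_mem t hT

/-- Each `Q j * (Q j)ᵀ` projects onto the column space of the `j`-th flattening, so together they
fix `T`. -/
theorem mem_tensorSubspace_colSpace (T : Tensor n) :
    T ∈ tensorSubspace fun j => colSpace (flatten j T) := by
  choose Q Q' L h1 h2 h3 h4 h5 h6 h7 h8 using fun j =>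
    exists_frames_of_rank_eq (flatten j T) rfl
  have h9 := mulTensor_mem_tensorSubspace h6 (mulTensor (fun j => (Q j)ᵀ) T)
  rwa [mulTensor_mulTensor, mulTensor_eq_self h8] at h9

/-- The multilinear rank is the tuple of the ranks of the flattenings. -/
theorem hasMultilinearRank_iff {T : Tensor n} :
    HasMultilinearRank T r ↔ ∀ j, (flatten j T).rank = r j := by
  have hleast : HasMultilinearRank T fun j => (flatten j T).rank := by
    refine ⟨⟨_, fun j => finrank_colSpace _, mem_tensorSubspace_colSpace T⟩, ?_⟩
    rintro s ⟨W, hW, hT⟩ j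
    change (flatten j T).rank ≤ s j
    rw [← hW j, ← finrank_colSpace]
    refine Submodule.finrank_mono (Submodule.span_le.2 ?_)
    rintro _ ⟨i, rfl⟩
    exact flatten_col_mem hT j i
  constructor
  · intro h j
    exact congrFun (hleast.unique h) j
  · intro h
    have : (fun j => (flatten j T).rank) = r := funext h
    rwa [← this]

end Tensors

/-! ### Smoothness of determinants and inverses -/

section Smoothness

variable {E ι : Type*} [NormedAddCommGroup E] [NormedSpace ℝ E] [Fintype ι] [DecidableEq ι]

theorem contDiff_matrix_det {M : E → Matrix ι ι ℝ} (h : ∀ i j, ContDiff ℝ ∞ fun x => M x i j) :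
    ContDiff ℝ ∞ fun x => (M x).det := by
  simp only [Matrix.det_apply']
  exact ContDiff.sum fun σ _ => contDiff_const.mul (contDiff_prod fun i _ => h _ _)

/-- Cramer's rule: each entry is a quotient of two determinants. -/
theorem contDiffOn_matrix_inv_apply {M : E → Matrix ι ι ℝ} {O : Set E}
    (h : ∀ i j, ContDiff ℝ ∞ fun x => M x i j) (hO : ∀ x ∈ O, (M x).det ≠ 0) (i j : ι) :
    ContDiffOn ℝ ∞ (fun x => (M x)⁻¹ i j) O := by
  simp only [Matrix.inv_def, Ring.inverse_eq_inv', Matrix.smul_apply, smul_eq_mul,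
    Matrix.adjugate_apply]
  refine ((contDiff_matrix_det h).contDiffOn.inv hO).mul (ContDiff.contDiffOn ?_)
  refine contDiff_matrix_det fun k l => ?_
  simp only [Matrix.updateRow_apply]
  split_ifs
  · exact contDiff_const
  · exact h k l

end Smoothness

/-! ### Graph charts and lines on the Tucker manifold -/

section Charts

open Matrix

variable {d : ℕ} {n r : Fin d → ℕ}

/-- Orthonormal frames `Q j` of `r j`-dimensional subspaces of `ℝ^{n j}` and `Q' j` of their
orthogonal complements, together with matrices `L j` that normalize flattenings. -/
structure TuckerFrame (n r : Fin d → ℕ) where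
  Q : (j : Fin d) → Matrix (Fin (n j)) (Fin (r j)) ℝ
  Q' : (j : Fin d) → Matrix (Fin (n j)) (Fin (n j - r j)) ℝ
  L : (j : Fin d) → Matrix ((j : Fin d) → Fin (n j)) (Fin (r j)) ℝ
  QQ : ∀ j, (Q j)ᵀ * Q j = 1
  Q'Q' : ∀ j, (Q' j)ᵀ * Q' j = 1
  QQ' : ∀ j, (Q j)ᵀ * Q' j = 0
  Q'Q : ∀ j, (Q' j)ᵀ * Q j = 0
  resolution : ∀ j, Q j * (Q j)ᵀ + Q' j * (Q' j)ᵀ = 1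

/-- The parameter space of the charts of the Tucker manifold. -/
abbrev TuckerParam (n r : Fin d → ℕ) : Type :=
  Tensor r × ((j : Fin d) → Fin (n j - r j) → Fin (r j) → ℝ)

theorem finrank_tuckerParam (n r : Fin d → ℕ) :
    Module.finrank ℝ (TuckerParam n r) = (∑ j, r j * (n j - r j)) + ∏ j, r j := by
  rw [Module.finrank_prod, add_comm]
  congr 1
  · rw [Module.finrank_pi_fintype]
    refine Finset.sum_congr rfl fun j _ => ?_
    rw [Module.finrank_pi_fintype]
    simp [mul_comm]
  · simp

namespace TuckerFrame

variable (F : TuckerFrame n r)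

/-- The frame of the subspace that is the graph of `B`. -/
def graphFrame (B : (j : Fin d) → Fin (n j - r j) → Fin (r j) → ℝ) (j : Fin d) :
    Matrix (Fin (n j)) (Fin (r j)) ℝ :=
  F.Q j + F.Q' j * Matrix.of (B j)

/-- The parametrization of the Tucker manifold. -/
def param (y : TuckerParam n r) : Tensor n :=
  mulTensor (F.graphFrame y.2) y.1

/-- The tangential part of the normalized `j`-th flattening. -/
def tangential (j : Fin d) (S : Tensor n) : Matrix (Fin (r j)) (Fin (r j)) ℝ :=
  (F.Q j)ᵀ * (flatten j S * F.L j)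

/-- The normal part of the normalized `j`-th flattening. -/
def normal (j : Fin d) (S : Tensor n) : Matrix (Fin (n j - r j)) (Fin (r j)) ℝ :=
  (F.Q' j)ᵀ * (flatten j S * F.L j)

/-- The domain of the coordinates. -/
def domain : Set (Tensor n) :=
  {S | ∀ j, (F.tangential j S).det ≠ 0}

/-- The coordinates on the Tucker manifold. -/
def coord (S : Tensor n) : TuckerParam n r :=
  (mulTensor (fun j => (F.Q j)ᵀ) S, fun j a b => (F.normal j S * (F.tangential j S)⁻¹) a b)

theorem contDiff_param : ContDiff ℝ ∞ F.param := by
  rw [contDiff_euclidean]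
  intro i
  simp only [param, mulTensor_apply, graphFrame, Matrix.add_apply, Matrix.mul_apply,
    Matrix.of_apply]
  refine ContDiff.sum fun k _ => ContDiff.mul (contDiff_prod fun j _ => ?_) (by fun_prop)
  refine contDiff_const.add (ContDiff.sum fun a _ => contDiff_const.mul ?_)
  exact contDiff_pi.1 (contDiff_pi.1 (contDiff_pi.1 contDiff_snd j) a) (k j)

theorem contDiff_tangential (j : Fin d) (a b : Fin (r j)) :
    ContDiff ℝ ∞ fun S => F.tangential j S a b := by
  simp only [tangential, flatten, Matrix.mul_apply, Matrix.of_apply]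
  fun_prop

theorem contDiff_normal (j : Fin d) (a : Fin (n j - r j)) (b : Fin (r j)) :
    ContDiff ℝ ∞ fun S => F.normal j S a b := by
  simp only [normal, flatten, Matrix.mul_apply, Matrix.of_apply]
  fun_prop

theorem isOpen_domain : IsOpen F.domain := by
  simp only [domain, Set.ofPred_forall]
  refine isOpen_iInter_of_finite fun j => ?_
  exact isOpen_ne.preimage (contDiff_matrix_det (F.contDiff_tangential j)).continuous

theorem contDiffOn_coord : ContDiffOn ℝ ∞ F.coord F.domain := by
  refine ContDiffOn.prodMk ?_ ?_
  · refine ContDiff.contDiffOn ?_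
    exact (LinearMap.toContinuousLinearMap (mulTensor fun j => (F.Q j)ᵀ)).contDiff
  · simp only [contDiffOn_pi, Matrix.mul_apply]
    intro j a b
    refine ContDiffOn.sum fun c _ => ?_
    exact (F.contDiff_normal j a c).contDiffOn.mul
      (contDiffOn_matrix_inv_apply (F.contDiff_tangential j)
        (fun S (hS : S ∈ F.domain) => hS j) c b)

theorem transpose_Q_mul_graphFrame (B : (j : Fin d) → Fin (n j - r j) → Fin (r j) → ℝ)
    (j : Fin d) : (F.Q j)ᵀ * F.graphFrame B j = 1 := by
  rw [graphFrame, Matrix.mul_add, ← Matrix.mul_assoc, F.QQ, F.QQ', Matrix.zero_mul, add_zero]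

theorem transpose_Q'_mul_graphFrame (B : (j : Fin d) → Fin (n j - r j) → Fin (r j) → ℝ)
    (j : Fin d) : (F.Q' j)ᵀ * F.graphFrame B j = Matrix.of (B j) := by
  rw [graphFrame, Matrix.mul_add, ← Matrix.mul_assoc, F.Q'Q, F.Q'Q', Matrix.one_mul, zero_add]

/-- Multiplying by `(Q j)ᵀ` turns each graph frame into `1` and returns the core. In a flattening,
the normal part is `B j` times the tangential part, so the quotient returns `B j`. -/
theorem coord_param (y : TuckerParam n r) (hy : F.param y ∈ F.domain) :
    F.coord (F.param y) = y := by
  refine Prod.ext ?_ ?_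
  · simp only [coord, param, mulTensor_mulTensor, transpose_Q_mul_graphFrame, mulTensor_one]
  · funext j
    have hdet := hy j
    have h1 : F.normal j (F.param y) = Matrix.of (y.2 j) * F.tangential j (F.param y) := by
      rw [normal, tangential, param, flatten_mulTensor, Matrix.mul_assoc,
        ← Matrix.mul_assoc (F.Q' j)ᵀ, ← Matrix.mul_assoc (F.Q j)ᵀ, transpose_Q'_mul_graphFrame,
        transpose_Q_mul_graphFrame, Matrix.one_mul]
    have h2 : F.normal j (F.param y) * (F.tangential j (F.param y))⁻¹ = Matrix.of (y.2 j) := by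
      rw [h1, Matrix.mul_assoc, Matrix.mul_nonsing_inv _ (isUnit_iff_ne_zero.2 hdet),
        Matrix.mul_one]
    funext a b
    exact congrFun (congrFun h2 a) b

theorem le_rank_flatten_mul {S : Tensor n} (hS : S ∈ F.domain) (j : Fin d) :
    r j ≤ (flatten j S * F.L j).rank := by
  have h1 : (F.tangential j S).rank = r j := by
    simpa using Matrix.rank_of_isUnit _
      ((Matrix.isUnit_iff_isUnit_det _).2 (isUnit_iff_ne_zero.2 (hS j)))
  exact h1.symm.trans_le (Matrix.rank_mul_le_right _ _)

/-- The frame has only `r j` columns, which bounds the rank above; the invertible tangential part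
bounds it below. -/
theorem param_mem (y : TuckerParam n r) (hy : F.param y ∈ F.domain) :
    F.param y ∈ tuckerManifold n r := by
  refine hasMultilinearRank_iff.2 fun j => le_antisymm ?_ ?_
  · rw [param, flatten_mulTensor]
    refine (Matrix.rank_mul_le_left _ _).trans ?_
    simpa using Matrix.rank_le_card_width (F.graphFrame y.2 j)
  · exact (F.le_rank_flatten_mul hy j).trans (Matrix.rank_mul_le_left _ _)

/-- The graph frame is `flatten j S * L j`, normalized to have tangential part `1`. As `S` has rank
`r`, its flattening factors through `flatten j S * L j`, so the frame times `(Q j)ᵀ` fixes it. -/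
theorem param_coord {S : Tensor n} (hS : S ∈ tuckerManifold n r) (hSF : S ∈ F.domain) :
    F.param (F.coord S) = S := by
  simp only [param, coord]
  rw [mulTensor_mulTensor]
  refine mulTensor_eq_self fun j => ?_
  have hunit : IsUnit (F.tangential j S).det := isUnit_iff_ne_zero.2 (hSF j)
  have h1 : F.graphFrame (fun j a b => (F.normal j S * (F.tangential j S)⁻¹) a b) j =
      flatten j S * F.L j * (F.tangential j S)⁻¹ := by
    change F.Q j + F.Q' j * (F.normal j S * (F.tangential j S)⁻¹) = _
    have h2 : F.Q j = F.Q j * F.tangential j S * (F.tangential j S)⁻¹ := by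
      rw [Matrix.mul_assoc, Matrix.mul_nonsing_inv _ hunit, Matrix.mul_one]
    rw [h2, ← Matrix.mul_assoc (F.Q' j), ← Matrix.add_mul, tangential, normal,
      ← Matrix.mul_assoc (F.Q j), ← Matrix.mul_assoc (F.Q' j), ← Matrix.add_mul, F.resolution,
      Matrix.one_mul]
  obtain ⟨G, hG⟩ := exists_eq_mul_mul_of_rank_le (flatten j S) (F.L j)
    ((hasMultilinearRank_iff.1 hS j).trans_le (F.le_rank_flatten_mul hSF j))
  rw [h1]
  calc flatten j S * F.L j * (F.tangential j S)⁻¹ * (F.Q j)ᵀ * flatten j S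
      = flatten j S * F.L j * (F.tangential j S)⁻¹ * (F.Q j)ᵀ * (flatten j S * F.L j * G) := by
        rw [← hG]
    _ = flatten j S * F.L j * ((F.tangential j S)⁻¹ * F.tangential j S) * G := by
        simp only [tangential, Matrix.mul_assoc]
    _ = flatten j S := by
        rw [Matrix.nonsing_inv_mul _ hunit, Matrix.mul_one, ← hG]

/-- The chart attached to a frame. -/
theorem isLocalParametrization
    (e : EuclideanSpace ℝ (Fin ((∑ j, r j * (n j - r j)) + ∏ j, r j)) ≃L[ℝ] TuckerParam n r) :
    IsLocalParametrization (tuckerManifold n r) ((F.param ∘ e) ⁻¹' F.domain) (F.param ∘ e) :=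
  isLocalParametrization_of_leftInverse e F.contDiff_param F.isOpen_domain F.contDiffOn_coord
    F.coord_param F.param_mem fun _ => F.param_coord

end TuckerFrame

/-- Every tensor of multilinear rank `r` is the centre of a chart. -/
theorem exists_tuckerFrame {T : Tensor n} (hT : T ∈ tuckerManifold n r) :
    ∃ F : TuckerFrame n r, (∀ j, flatten j T * F.L j = F.Q j) ∧
      mulTensor F.Q (mulTensor (fun j => (F.Q j)ᵀ) T) = T := by
  choose Q Q' L h1 h2 h3 h4 h5 h6 h7 h8 using fun j =>
    exists_frames_of_rank_eq (flatten j T) (hasMultilinearRank_iff.1 hT j)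
  refine ⟨⟨Q, Q', L, h1, h2, h3, h4, h5⟩, h7, ?_⟩
  rw [mulTensor_mulTensor]
  exact mulTensor_eq_self h8

namespace TuckerFrame

variable (F : TuckerFrame n r) {T : Tensor n}

theorem mem_domain (hL : ∀ j, flatten j T * F.L j = F.Q j) : T ∈ F.domain := by
  intro j
  rw [tangential, hL, F.QQ, Matrix.det_one]
  exact one_ne_zero

/-- The variations of the `j`-th factor subspace. -/
def slotMap (C : Tensor r) (j : Fin d) :
    Matrix (Fin (n j - r j)) (Fin (r j)) ℝ →ₗ[ℝ] Tensor n where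
  toFun B := mulTensorSlot F.Q C j (F.Q' j * B)
  map_add' B B' := by rw [Matrix.mul_add, map_add]
  map_smul' t B := by rw [Matrix.mul_smul, map_smul, RingHom.id_apply]

theorem slotMap_apply (C : Tensor r) (j : Fin d) (B : Matrix (Fin (n j - r j)) (Fin (r j)) ℝ) :
    F.slotMap C j B = mulTensor (Function.update F.Q j (F.Q' j * B)) C := rfl

theorem mulTensor_Q_injective : Function.Injective (mulTensor F.Q) := by
  refine Function.LeftInverse.injective (g := mulTensor fun j => (F.Q j)ᵀ) fun C => ?_
  simp only [mulTensor_mulTensor, F.QQ, mulTensor_one]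

/-- `L j` is a right inverse of the right factor of the `j`-th flattening, so `B` can be recovered
from the flattening of its image. -/
theorem slotMap_injective {C : Tensor r} (hC : mulTensor F.Q C = T)
    (hL : ∀ j, flatten j T * F.L j = F.Q j) (j : Fin d) :
    Function.Injective (F.slotMap C j) := by
  have hZ : flattenFactor j F.Q C * F.L j = 1 := by
    calc flattenFactor j F.Q C * F.L j
        = (F.Q j)ᵀ * (flatten j T * F.L j) := by
          rw [← hC, flatten_mulTensor, Matrix.mul_assoc, ← Matrix.mul_assoc (F.Q j)ᵀ, F.QQ,
            Matrix.one_mul]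
      _ = 1 := by rw [hL, F.QQ]
  refine (injective_iff_map_eq_zero _).2 fun B hB => ?_
  have h1 : F.Q' j * B * flattenFactor j F.Q C = 0 := by
    rw [← flatten_mulTensorSlot]
    change flatten j (F.slotMap C j B) = 0
    rw [hB]
    rfl
  calc B = (F.Q' j)ᵀ * (F.Q' j * B * flattenFactor j F.Q C) * F.L j := by
        rw [Matrix.mul_assoc (F.Q' j), ← Matrix.mul_assoc, F.Q'Q', Matrix.one_mul,
          Matrix.mul_assoc, hZ, Matrix.mul_one]
    _ = 0 := by rw [h1, Matrix.mul_zero, Matrix.zero_mul]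

/-- The pieces of the tangent space at the centre of a chart. -/
def piece (C : Tensor r) : Option (Fin d) → Submodule ℝ (Tensor n)
  | none => LinearMap.range (mulTensor F.Q)
  | some j => LinearMap.range (F.slotMap C j)

theorem inner_mulTensor_slotMap (C D : Tensor r) (j : Fin d)
    (B : Matrix (Fin (n j - r j)) (Fin (r j)) ℝ) :
    inner ℝ (mulTensor F.Q D) (F.slotMap C j B) = 0 := by
  rw [slotMap_apply, inner_mulTensor_mulTensor, mulTensor_eq_zero (j := j), inner_zero_right]
  rw [Function.update_self, ← Matrix.mul_assoc, F.QQ', Matrix.zero_mul]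

theorem inner_slotMap_slotMap (C : Tensor r) {j k : Fin d} (hjk : j ≠ k)
    (B : Matrix (Fin (n j - r j)) (Fin (r j)) ℝ) (B' : Matrix (Fin (n k - r k)) (Fin (r k)) ℝ) :
    inner ℝ (F.slotMap C j B) (F.slotMap C k B') = 0 := by
  rw [slotMap_apply, slotMap_apply, inner_mulTensor_mulTensor, mulTensor_eq_zero (j := j),
    inner_zero_right]
  rw [Function.update_self, Function.update_of_ne hjk, Matrix.transpose_mul, Matrix.mul_assoc,
    F.Q'Q, Matrix.mul_zero]

theorem orthogonalFamily_piece (C : Tensor r) :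
    OrthogonalFamily ℝ (fun k => F.piece C k) fun k => (F.piece C k).subtypeₗᵢ := by
  rintro (_ | j) (_ | k) hjk ⟨_, D, rfl⟩ ⟨_, D', rfl⟩
  · exact absurd rfl hjk
  · exact F.inner_mulTensor_slotMap C D k D'
  · exact (real_inner_comm _ _).trans (F.inner_mulTensor_slotMap C D' j D)
  · exact F.inner_slotMap_slotMap C (fun h => hjk (congrArg some h)) D D'

theorem sum_finrank_piece {C : Tensor r} (hC : mulTensor F.Q C = T)
    (hL : ∀ j, flatten j T * F.L j = F.Q j) :
    ∑ k, Module.finrank ℝ (F.piece C k) = (∑ j, r j * (n j - r j)) + ∏ j, r j := by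
  rw [Fintype.sum_option, add_comm]
  congr 1
  · refine Finset.sum_congr rfl fun j _ => ?_
    refine (LinearMap.finrank_range_of_inj (F.slotMap_injective hC hL j)).trans ?_
    simp [Module.finrank_matrix, mul_comm]
  · refine (LinearMap.finrank_range_of_inj F.mulTensor_Q_injective).trans ?_
    simp

/-- The pieces of the tangent space consist of directions of lines in the image of a chart. -/
theorem exists_param_eq_add {C : Tensor r} (hC : mulTensor F.Q C = T) {k : Option (Fin d)}
    {v : Tensor n} (hv : v ∈ F.piece C k) (t : ℝ) : ∃ y, F.param y = T + t • v := by
  rcases k with _ | j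
  · obtain ⟨D, rfl⟩ := hv
    refine ⟨(C + t • D, 0), ?_⟩
    have h0 : F.graphFrame 0 = F.Q := by
      funext j
      change F.Q j + F.Q' j * 0 = F.Q j
      rw [Matrix.mul_zero, add_zero]
    simp only [param, h0, map_add, map_smul, hC]
  · obtain ⟨B, rfl⟩ := hv
    -- Tilt only the `j`-th subspace; the result is affine in `t` because the multiplication is
    -- linear in that slot.
    refine ⟨(C, Function.update 0 j (Matrix.of.symm (t • B))), ?_⟩
    have h0 : F.graphFrame (Function.update 0 j (Matrix.of.symm (t • B))) =
        Function.update F.Q j (F.Q j + t • (F.Q' j * B)) := by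
      funext l
      by_cases hl : l = j
      · subst hl
        rw [graphFrame, Function.update_self, Function.update_self]
        rw [Equiv.apply_symm_apply, Matrix.mul_smul]
      · rw [graphFrame, Function.update_of_ne hl, Function.update_of_ne hl]
        change F.Q l + F.Q' l * 0 = F.Q l
        rw [Matrix.mul_zero, add_zero]
    simp only [param, h0]
    rw [← mulTensorSlot_apply, map_add, map_smul, mulTensorSlot_self, hC]
    rfl

/-- Orthonormal directions of line segments in the Tucker manifold, as many as its dimension. -/
theorem exists_orthonormal_lines {C : Tensor r} (hC : mulTensor F.Q C = T)
    (hL : ∀ j, flatten j T * F.L j = F.Q j) :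
    ∃ v : Fin ((∑ j, r j * (n j - r j)) + ∏ j, r j) → Tensor n, Orthonormal ℝ v ∧
      ∀ k, ∀ᶠ t in 𝓝 (0 : ℝ), T + t • v k ∈ tuckerManifold n r := by
  have horth := (F.orthogonalFamily_piece C).orthonormal_sigma_orthonormal
    fun k => (stdOrthonormalBasis ℝ (F.piece C k)).orthonormal
  have hcard : Fintype.card (Σ k, Fin (Module.finrank ℝ (F.piece C k))) =
      (∑ j, r j * (n j - r j)) + ∏ j, r j := by
    rw [Fintype.card_sigma, ← F.sum_finrank_piece hC hL]
    simp
  let e := (Fintype.equivFinOfCardEq hcard).symm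
  refine ⟨_, horth.comp e e.injective, fun k => ?_⟩
  have hcont : Continuous fun t : ℝ =>
      T + t • (stdOrthonormalBasis ℝ (F.piece C (e k).1) (e k).2 : Tensor n) := by fun_prop
  -- For small `t` the line stays in the open chart domain, which prevents the rank from dropping.
  have hnear := hcont.continuousAt.eventually_mem (x := 0)
    (F.isOpen_domain.mem_nhds (by simpa using F.mem_domain hL))
  filter_upwards [hnear] with t ht
  obtain ⟨y, hy⟩ := F.exists_param_eq_add hC
    (stdOrthonormalBasis ℝ (F.piece C (e k).1) (e k).2).2 t
  have := F.param_mem y (hy ▸ ht)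
  rwa [hy] at this

end TuckerFrame

/-- The truncated subtraction is harmless: if some `r j > n j`, the set is empty and both claims are
vacuous. -/
theorem isMinimalSubmanifold_tuckerManifold (n r : Fin d → ℕ) :
    IsMinimalSubmanifold (tuckerManifold n r) ((∑ j, r j * (n j - r j)) + ∏ j, r j) := by
  refine ⟨fun T hT => ?_, fun U ρ h u hu => ?_⟩
  · obtain ⟨F, hL, -⟩ := exists_tuckerFrame hT
    have hfin : Module.finrank ℝ
        (EuclideanSpace ℝ (Fin ((∑ j, r j * (n j - r j)) + ∏ j, r j))) =
        Module.finrank ℝ (TuckerParam n r) := by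
      rw [finrank_tuckerParam, finrank_euclideanSpace_fin]
    let e := ContinuousLinearEquiv.ofFinrankEq hfin
    have hTF : T ∈ F.domain := F.mem_domain hL
    have h1 : (F.param ∘ e) (e.symm (F.coord T)) = T := by
      simpa using F.param_coord hT hTF
    exact ⟨_, _, F.isLocalParametrization e, e.symm (F.coord T),
      by rw [Set.mem_preimage, h1]; exact hTF, h1⟩
  · have hT : ρ u ∈ tuckerManifold n r := by
      obtain ⟨O, -, hUO⟩ := h.isOpen_image
      have : ρ u ∈ tuckerManifold n r ∩ O := hUO ▸ Set.mem_image_of_mem ρ hu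
      exact this.1
    obtain ⟨F, hL, hC⟩ := exists_tuckerFrame hT
    obtain ⟨v, hv, hline⟩ := F.exists_orthonormal_lines hC hL
    exact h.meanCurvatureVector_eq_zero hu hv hline

end Charts

/-! ### Tensors of order two as matrices -/

section MatrixCase

theorem rank_flatten_zero {n : Fin 2 → ℕ} (T : Tensor n) :
    (flatten 0 T).rank = (toMatrix T).rank := by
  rw [Matrix.rank_eq_finrank_span_cols, Matrix.rank_eq_finrank_span_cols]
  suffices h : Submodule.span ℝ (Set.range (flatten 0 T).col) =
      Submodule.span ℝ (Set.range (toMatrix T).col) by rw [h]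
  refine le_antisymm (Submodule.span_le.2 ?_) (Submodule.span_le.2 ?_)
  · rintro _ ⟨i, rfl⟩
    refine Submodule.subset_span ⟨i 1, ?_⟩
    ext a
    refine congrArg T ?_
    funext j
    fin_cases j <;> rfl
  · rintro _ ⟨b, rfl⟩
    -- A column index of the flattening also has an irrelevant row entry, for which any `a₀` serves;
    -- without rows every column is zero.
    rcases isEmpty_or_nonempty (Fin (n 0)) with h | ⟨⟨a₀⟩⟩
    · rw [Subsingleton.elim ((toMatrix T).col b) 0]
      exact Submodule.zero_mem _
    · refine Submodule.subset_span ⟨Fin.cons a₀ (Fin.cons b finZeroElim), ?_⟩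
      ext a
      refine congrArg T ?_
      funext j
      fin_cases j <;> rfl

theorem rank_flatten_one {n : Fin 2 → ℕ} (T : Tensor n) :
    (flatten 1 T).rank = (toMatrix T).rank := by
  rw [← Matrix.rank_transpose (toMatrix T), Matrix.rank_eq_finrank_span_cols,
    Matrix.rank_eq_finrank_span_cols]
  suffices h : Submodule.span ℝ (Set.range (flatten 1 T).col) =
      Submodule.span ℝ (Set.range (toMatrix T).transpose.col) by rw [h]
  refine le_antisymm (Submodule.span_le.2 ?_) (Submodule.span_le.2 ?_)
  · rintro _ ⟨i, rfl⟩
    refine Submodule.subset_span ⟨i 0, ?_⟩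
    ext b
    refine congrArg T ?_
    funext j
    fin_cases j <;> rfl
  · rintro _ ⟨a, rfl⟩
    rcases isEmpty_or_nonempty (Fin (n 1)) with h | ⟨⟨b₀⟩⟩
    · rw [Subsingleton.elim ((toMatrix T).transpose.col a) 0]
      exact Submodule.zero_mem _
    · refine Submodule.subset_span ⟨Fin.cons a (Fin.cons b₀ finZeroElim), ?_⟩
      ext b
      refine congrArg T ?_
      funext j
      fin_cases j <;> rfl

theorem tuckerManifold_two (n : Fin 2 → ℕ) (r : ℕ) :
    tuckerManifold n (fun _ => r) = {T : Tensor n | (toMatrix T).rank = r} := by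
  ext T
  refine hasMultilinearRank_iff.trans ?_
  rw [Fin.forall_fin_two, rank_flatten_zero, rank_flatten_one, and_self]
  rfl

end MatrixCase

end TensorMinimality

end

theorem theorem1 :
    (∀ (d : ℕ) (_ : 1 ≤ d) (n r : Fin d → ℕ),
      TensorMinimality.IsMinimalSubmanifold (TensorMinimality.tuckerManifold n r)
        ((∑ j, r j * (n j - r j)) + ∏ j, r j)) ∧
    (∀ (n : Fin 2 → ℕ) (r : ℕ),
      TensorMinimality.tuckerManifold n (fun _ => r) =
          {T : TensorMinimality.Tensor n | (TensorMinimality.toMatrix T).rank = r} ∧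
        TensorMinimality.IsMinimalSubmanifold
          {T : TensorMinimality.Tensor n | (TensorMinimality.toMatrix T).rank = r}
          (r * (n 0 - r) + r * (n 1 - r) + r * r)) := by
  refine ⟨fun d _ n r => TensorMinimality.isMinimalSubmanifold_tuckerManifold n r,
    fun n r => ⟨TensorMinimality.tuckerManifold_two n r, ?_⟩⟩
  have h := TensorMinimality.isMinimalSubmanifold_tuckerManifold n (fun _ => r)
  rwa [TensorMinimality.tuckerManifold_two, Fin.sum_univ_two, Fin.prod_univ_two] at h
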